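/- All graphs are finite and simple. A linear forest is a graph each of whose connected components is a path (an isolated vertex being a path on one vertex). For $k\ge 1$ and $n\ge k+1$ let $\mathcal L_{n,k}$ be the family of all linear forests with exactly $n$ vertices and exactly $k$ edges; a graph $G$ is $\mathcal L_{n,k}$-free if no (not necessarily induced) subgraph of $G$ is isomorphic to a member of $\mathcal L_{n,k}$. Let $K^*_{s,t}$ be the graph obtained from the complete bipartite graph $K_{s,t}$ by making its part of size $s$ a clique, and let $ex(n,K^*_{s,t},\mathcal L_{n,k})$ be the maximum number of copies of $K^*_{s,t}$ (that is, of not necessarily induced subgraphs isomorphic to $K^*_{s,t}$) in an $\mathcal L_{n,k}$-free graph on $n$ vertices. Theorem. Let $s\ge 1$, $t\ge 2$, $k\ge 1$ and $n\ge k+1$ be integers, and put $p=\lceil\frac{k+1}{2}\rceil$, $q=\lfloor\frac{k-1}{2}\rfloor$. Then $$ex(n,K^*_{s,t},\mathcal L_{n,k})=\max\left\{\binom{k}{s+t}\binom{s+t}{t},\ \binom{q}{s}\binom{n-s}{t}+(n-p)\binom{q}{s-1}\binom{q-s+1}{t}+\left(\binom{p}{s}-\binom{q}{s}\right)\binom{p-s}{t}\right\},$$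 where any product with a factor $\binom{a}{b}$, $0\le a<b$, is $0$. -/

import Mathlib

namespace SimpleGraph

/-- A linear forest: every connected component is a path (isolated vertices are the paths on one
vertex). -/
def IsLinearForest {V : Type*} (F : SimpleGraph V) : Prop :=
  ∀ c : F.ConnectedComponent, ∃ m : ℕ, Nonempty (c.toSimpleGraph ≃g pathGraph m)

/-- The family of all linear forests of order `n` with exactly `k` edges. -/
def linearForests (n k : ℕ) : Set (SimpleGraph (Fin n)) :=
  {F | F.IsLinearForest ∧ F.edgeSet.ncard = k}

/-- `G` is free of the family `𝓕`: no subgraph of `G`, induced or not, is isomorphic to a member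
of `𝓕`. -/
def FamilyFree {V W : Type*} (𝓕 : Set (SimpleGraph W)) (G : SimpleGraph V) : Prop :=
  ∀ F ∈ 𝓕, F.Free G

/-- The complete bipartite graph with sides of size `s` and `t`, the side of size `s` made into a
clique. -/
def cliqueBipartite (s t : ℕ) : SimpleGraph (Fin s ⊕ Fin t) :=
  completeBipartiteGraph (Fin s) (Fin t) ⊔ ((⊤ : SimpleGraph (Fin s)) ⊕g (⊥ : SimpleGraph (Fin t)))

/-- `N` is the generalized Turán number of `T` and `𝓕` on `n` vertices: the maximum number of
copies of `T` (subgraphs isomorphic to `T`) in an `𝓕`-free graph on `n` vertices. The maximum is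
attained. -/
def IsGeneralizedTuranNumber {U W : Type*} (n : ℕ) (T : SimpleGraph U)
    (𝓕 : Set (SimpleGraph W)) (N : ℕ) : Prop :=
  IsGreatest {c | ∃ G : SimpleGraph (Fin n), FamilyFree 𝓕 G ∧ G.copyCount T = c} N

end SimpleGraph

/-! Upper bound. Laying linear forests along vertex orderings shows that in a free graph every
ordering has fewer than `k` adjacent consecutive pairs. Enlarge the graph to be edge-maximal with
this property. An Ore-type exchange then gives `d u + d v < k` for non-adjacent `u`, `v`, and a
non-adjacent pair of largest degree sum yields Chvátal-type sets `R ⊆ A` of sizes `r` and `k - r`: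
degrees are at most `r` outside `A` and at most `k - r - 1` outside `R` (`ChainsLT.exists_degrees`).

For `t ≥ 2` a copy of `cliqueBipartite s t` is an `s`-clique `S` with a `t`-set of common
neighbours. Sorting the cliques into `S ⊆ R`, `S ⊆ A` but not in `R`, and the rest, the degree
bounds give at most `splitCopies s t n k r` copies (`sum_choose_commonNbrs_le`). This is convex in
`r` on `0 ≤ r ≤ q`, so an endpoint is largest (`splitCopies_le_max`); the endpoints are the two
terms of the maximum.

Lower bound. `splitGraph R A` with the same sizes has at least that many copies, and it is free
because a linear forest has at most two edges at each vertex of `R` and fewer than `|A \ R|` edges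
inside a nonempty `A \ R`. -/

/-- The number of copies of `cliqueBipartite s t` in the split-type graph on `n` vertices with `r`
dominating vertices and a clique on `k - r` vertices containing them. -/
def splitCopies (s t n k r : ℕ) : ℕ :=
  r.choose s * (n - s).choose t + (n - (k - r)) * r.choose (s - 1) * (r + 1 - s).choose t
    + ((k - r).choose s - r.choose s) * (k - r - s).choose t

/-! ### Convexity of the count in `r`. -/

theorem le_max_of_convex (f : ℕ → ℕ) (q : ℕ)
    (h : ∀ r, r + 2 ≤ q → 2 * f (r + 1) ≤ f r + f (r + 2)) (r : ℕ) (hr : r ≤ q) :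
    f r ≤ max (f 0) (f q) := by
  -- By convexity, a descent at `m` forces descents all the way back to `0`.
  have key : ∀ m, m + 1 ≤ q → f (m + 1) < f m → f m ≤ f 0 := by
    intro m
    induction m with
    | zero => intro _ _; exact le_rfl
    | succ m ih =>
      intro h1 h2
      rw [show m + 1 + 1 = m + 2 by omega] at h2
      have h3 := h m (by omega)
      have h4 := ih (by omega) (by omega)
      omega
  induction q with
  | zero =>
    obtain rfl : r = 0 := by omega
    simp
  | succ q ih =>
    rcases Nat.lt_or_ge q r with h1 | h1
    · obtain rfl : r = q + 1 := by omega
      simp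
    · have h2 := ih (fun r hr => h r (by omega)) h1 (fun m hm => key m (by omega))
      have h3 := key q (by omega)
      rcases le_max_iff.1 h2 with h4 | h4 <;> rw [le_max_iff] <;> omega

/-- Chebyshev: `4by ≤ (a + c)(x + z) ≤ 2(ax + cz)`, the last gap being `(c - a)(z - x)`. -/
theorem mul_convex_of_mono {a b c x y z : ℕ} (h1 : a ≤ b) (h2 : b ≤ c) (h3 : x ≤ y) (h4 : y ≤ z)
    (h5 : 2 * b ≤ a + c) (h6 : 2 * y ≤ x + z) : 2 * (b * y) ≤ a * x + c * z := by
  have e1 := Nat.mul_le_mul h5 h6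
  obtain ⟨u, rfl⟩ := Nat.exists_eq_add_of_le (h1.trans h2)
  obtain ⟨v, rfl⟩ := Nat.exists_eq_add_of_le (h3.trans h4)
  nlinarith [Nat.zero_le (u * v)]

theorem mul_convex_of_anti {a b c x y z : ℕ} (h1 : a ≤ b) (h2 : b ≤ c) (h3 : x ≤ y) (h4 : y ≤ z)
    (h5 : 2 * b ≤ c + a) (h6 : 2 * y ≤ z + x) : 2 * (b * y) ≤ c * z + a * x := by
  have := mul_convex_of_mono h1 h2 h3 h4 (by omega) (by omega)
  omega

theorem choose_convex (r s : ℕ) : 2 * (r + 1).choose s ≤ r.choose s + (r + 2).choose s := by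
  cases s with
  | zero => simp
  | succ s =>
    have h1 := Nat.choose_succ_succ r s
    have h2 := Nat.choose_succ_succ (r + 1) s
    have h3 := Nat.choose_le_choose s (Nat.le_succ r)
    simp only [Nat.succ_eq_add_one, show r + 1 + 1 = r + 2 by omega] at *
    omega

theorem choose_tsub_convex (m t : ℕ) (ht : 1 ≤ t) :
    2 * (m - 1).choose t ≤ m.choose t + (m - 2).choose t := by
  match m with
  | 0 => simp; omega
  | 1 =>
    obtain ⟨t, rfl⟩ := Nat.exists_eq_add_of_le' ht
    simp
  | m + 2 =>
    have := choose_convex m t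
    simp only [Nat.add_sub_cancel, show m + 2 - 1 = m + 1 by omega]
    omega

/-- Second differences of `choose · s` are `choose · (s - 2)`, which is larger at `a` than at `r`.
The last summand repays the truncated subtraction and vanishes once `r + 2 ≤ a`. -/
theorem choose_sub_choose_convex (a r s : ℕ) (h : r ≤ a) :
    2 * ((a + 1).choose s - (r + 1).choose s) ≤
      ((a + 2).choose s - r.choose s) + (a.choose s - (r + 2).choose s)
      + ((r + 2).choose s - a.choose s) := by
  match s with
  | 0 => simp
  | 1 => simp; omega
  | s + 2 =>
    have h1 := Nat.choose_succ_succ r s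
    have h2 := Nat.choose_succ_succ r (s + 1)
    have h3 := Nat.choose_succ_succ (r + 1) (s + 1)
    have h1' := Nat.choose_succ_succ a s
    have h2' := Nat.choose_succ_succ a (s + 1)
    have h3' := Nat.choose_succ_succ (a + 1) (s + 1)
    have h4 := Nat.choose_le_choose s h
    have h5 := Nat.choose_le_choose (s + 1) h
    have h6 := Nat.choose_le_choose (s + 2) h
    simp only [Nat.succ_eq_add_one, show s + 1 + 1 = s + 2 by omega,
      show r + 1 + 1 = r + 2 by omega, show a + 1 + 1 = a + 2 by omega] at *
    omega

/-- Makes the dependence on `r` a single binomial coefficient, so that `choose_convex` applies. -/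
theorem choose_mul_choose_sub (r s t : ℕ) (hs : 1 ≤ s) :
    r.choose (s - 1) * (r + 1 - s).choose t = r.choose (s - 1 + t) * (s - 1 + t).choose (s - 1) := by
  rw [Nat.choose_mul (Nat.le_add_right _ _)]
  congr 2 <;> omega

theorem splitCopies_convex {s t n k q r : ℕ} (hs : 1 ≤ s) (ht : 1 ≤ t) (hn : k + 1 ≤ n)
    (hq : 2 * q + 1 ≤ k) (hr : r + 2 ≤ q) :
    2 * splitCopies s t n k (r + 1) ≤ splitCopies s t n k r + splitCopies s t n k (r + 2) := by
  have T1 := Nat.mul_le_mul_right ((n - s).choose t) (choose_convex r s)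
  have T2 : 2 * ((n - (k - (r + 1))) * ((r + 1).choose (s - 1 + t) * (s - 1 + t).choose (s - 1))) ≤
      (n - (k - r)) * (r.choose (s - 1 + t) * (s - 1 + t).choose (s - 1)) +
      (n - (k - (r + 2))) * ((r + 2).choose (s - 1 + t) * (s - 1 + t).choose (s - 1)) := by
    apply mul_convex_of_mono
    · omega
    · omega
    · exact Nat.mul_le_mul_right _ (Nat.choose_le_choose _ (by omega))
    · exact Nat.mul_le_mul_right _ (Nat.choose_le_choose _ (by omega))
    · omega
    · have := Nat.mul_le_mul_right ((s - 1 + t).choose (s - 1)) (choose_convex r (s - 1 + t))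
      linarith
  have T3 : 2 * (((k - (r + 1)).choose s - (r + 1).choose s) * (k - (r + 1) - s).choose t) ≤
      ((k - r).choose s - r.choose s) * (k - r - s).choose t +
      ((k - (r + 2)).choose s - (r + 2).choose s) * (k - (r + 2) - s).choose t := by
    apply mul_convex_of_anti
    · have := Nat.choose_le_choose s (show k - (r + 2) ≤ k - (r + 1) by omega)
      have := Nat.choose_le_choose s (show r + 1 ≤ r + 2 by omega)
      omega
    · have := Nat.choose_le_choose s (show k - (r + 1) ≤ k - r by omega)
      have := Nat.choose_le_choose s (show r ≤ r + 1 by omega)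
      omega
    · exact Nat.choose_le_choose _ (by omega)
    · exact Nat.choose_le_choose _ (by omega)
    · have h := choose_sub_choose_convex (k - (r + 2)) r s (by omega)
      have h0 := Nat.choose_le_choose s (show r + 2 ≤ k - (r + 2) by omega)
      rw [show k - (r + 2) + 1 = k - (r + 1) by omega, show k - (r + 2) + 2 = k - r by omega] at h
      omega
    · have := choose_tsub_convex (k - r - s) t ht
      rwa [show k - r - s - 1 = k - (r + 1) - s by omega,
        show k - r - s - 2 = k - (r + 2) - s by omega] at this
  simp only [splitCopies, mul_assoc, choose_mul_choose_sub _ _ _ hs]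
  linarith

theorem splitCopies_le_max {s t n k q r : ℕ} (hs : 1 ≤ s) (ht : 1 ≤ t) (hn : k + 1 ≤ n)
    (hq : 2 * q + 1 ≤ k) (hr : r ≤ q) :
    splitCopies s t n k r ≤ max (splitCopies s t n k 0) (splitCopies s t n k q) :=
  le_max_of_convex _ q (fun _ h => splitCopies_convex hs ht hn hq h) r hr

theorem splitCopies_zero {s t n k : ℕ} (hs : 1 ≤ s) (ht : 1 ≤ t) :
    splitCopies s t n k 0 = k.choose (s + t) * (s + t).choose t := by
  have h : (0 + 1 - s).choose t = 0 ∨ Nat.choose 0 (s - 1) = 0 := by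
    rcases Nat.lt_or_ge 1 s with h | h
    · right; exact Nat.choose_eq_zero_of_lt (by omega)
    · left; exact Nat.choose_eq_zero_of_lt (by omega)
  have h' : (n - (k - 0)) * Nat.choose 0 (s - 1) * (0 + 1 - s).choose t = 0 := by
    rcases h with h | h <;> simp [h]
  rw [splitCopies, h', Nat.choose_eq_zero_of_lt (show 0 < s by omega)]
  have := Nat.choose_mul (n := k) (k := s + t) (s := s) (by omega)
  rw [← Nat.choose_symm_add, this]
  simp

/-! ### Vertex orderings and the degree condition. -/

namespace SimpleGraph
open scoped Classical

variable {V : Type*} (G : SimpleGraph V)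

/-- The number of edges, `0` or `1`, between two optional vertices. -/
noncomputable def optAdj : Option V → Option V → ℕ
  | some a, some b => if G.Adj a b then 1 else 0
  | _, _ => 0

/-- The number of consecutive adjacent pairs in a list of vertices. -/
noncomputable def chainEdges : List V → ℕ
  | [] => 0
  | a :: l => G.optAdj (some a) l.head? + chainEdges l

@[simp] theorem optAdj_none_left (o : Option V) : G.optAdj none o = 0 := by simp [optAdj]

@[simp] theorem optAdj_none_right (o : Option V) : G.optAdj o none = 0 := by cases o <;> simp [optAdj]

theorem optAdj_some (a b : V) : G.optAdj (some a) (some b) = if G.Adj a b then 1 else 0 := rfl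

theorem optAdj_comm (o o' : Option V) : G.optAdj o o' = G.optAdj o' o := by
  cases o <;> cases o' <;> simp [optAdj, G.adj_comm]

theorem optAdj_le_one (o o' : Option V) : G.optAdj o o' ≤ 1 := by
  cases o <;> cases o' <;> simp only [optAdj, zero_le_one]
  split_ifs <;> simp

theorem chainEdges_append (l₁ l₂ : List V) :
    G.chainEdges (l₁ ++ l₂) =
      G.chainEdges l₁ + G.optAdj l₁.getLast? l₂.head? + G.chainEdges l₂ := by
  induction l₁ with
  | nil => simp [chainEdges]
  | cons a l ih =>
    simp only [List.cons_append, chainEdges, ih]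
    cases l with
    | nil => simp [chainEdges]
    | cons b l => simp [List.getLast?_cons_cons]; ring

theorem chainEdges_reverse (l : List V) : G.chainEdges l.reverse = G.chainEdges l := by
  induction l with
  | nil => simp
  | cons a l ih =>
    rw [List.reverse_cons, chainEdges_append, ih, List.getLast?_reverse, optAdj_comm]
    simp [chainEdges]; ring

theorem chainEdges_eq_sum (l : List V) :
    G.chainEdges l = ∑ i ∈ Finset.range (l.length - 1), G.optAdj l[i]? l[i + 1]? := by
  induction l with
  | nil => simp [chainEdges]
  | cons a l ih =>
    cases l with
    | nil => simp [chainEdges]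
    | cons b l =>
      rw [chainEdges, ih]
      simp only [List.length_cons, Nat.add_sub_cancel]
      rw [Finset.sum_range_succ']
      simp [add_comm _ (G.optAdj (some a) (some b))]

theorem chainEdges_rotate (l : List V) {i : ℕ} (hi : i + 1 < l.length) :
    G.chainEdges (l.drop (i + 1) ++ l.take (i + 1)) + G.optAdj l[i]? l[i + 1]? =
      G.chainEdges l + G.optAdj l.getLast? l.head? := by
  have h := G.chainEdges_append (l.take (i + 1)) (l.drop (i + 1))
  rw [List.take_append_drop] at h
  rw [h, chainEdges_append]
  have e1 : (l.take (i + 1)).getLast? = l[i]? := by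
    rw [List.getLast?_take]; simp [List.getElem?_eq_getElem (show i < l.length by omega)]
  have e2 : (l.drop (i + 1)).getLast? = l.getLast? := by
    rw [List.getLast?_drop]; simp; omega
  have e3 : (l.take (i + 1)).head? = l.head? := by
    rw [List.head?_take]; simp
  rw [e1, e2, e3, List.head?_drop]
  ring

theorem chainEdges_flip (l : List V) {i : ℕ} (hi : i + 1 < l.length) :
    G.chainEdges ((l.take (i + 1)).reverse ++ l.drop (i + 1)) + G.optAdj l[i]? l[i + 1]? =
      G.chainEdges l + G.optAdj l.head? l[i + 1]? := by
  have h := G.chainEdges_append (l.take (i + 1)) (l.drop (i + 1))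
  rw [List.take_append_drop] at h
  rw [h, chainEdges_append, chainEdges_reverse]
  have e1 : (l.take (i + 1)).getLast? = l[i]? := by
    rw [List.getLast?_take]; simp [List.getElem?_eq_getElem (show i < l.length by omega)]
  have e3 : (l.take (i + 1)).head? = l.head? := by
    rw [List.head?_take]; simp
  rw [List.getLast?_reverse, e1, e3, List.head?_drop]
  ring

/-- Every ordering of the vertices has fewer than `k` adjacent consecutive pairs. -/
def ChainsLT (k : ℕ) : Prop :=
  ∀ l : List V, l.Nodup → (∀ v, v ∈ l) → G.chainEdges l < k

variable {G}

/-- If the closed-up ordering had `k` adjacent pairs, every rotation would have to lose one at its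
cut, so all consecutive pairs would be adjacent; the ordering itself would then have `length - 1 ≥
k` of them. -/
theorem ChainsLT.cyclic {k : ℕ} (h : G.ChainsLT k) {l : List V} (hl : l.Nodup)
    (hm : ∀ v, v ∈ l) (hk : k + 1 ≤ l.length) :
    G.chainEdges l + G.optAdj l.getLast? l.head? < k := by
  by_contra hc
  have h1 : ∀ i ∈ Finset.range (l.length - 1), G.optAdj l[i]? l[i + 1]? = 1 := by
    intro i hi
    have hi' : i + 1 < l.length := by simp at hi; omega
    have h2 := G.chainEdges_rotate l hi'
    have hp : (l.drop (i + 1) ++ l.take (i + 1)).Perm l := by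
      simpa using (List.perm_append_comm (l₁ := l.drop (i + 1)) (l₂ := l.take (i + 1)))
    have h3 := h _ (hp.nodup_iff.2 hl) (fun v => hp.mem_iff.2 (hm v))
    have h4 := G.optAdj_le_one l[i]? l[i + 1]?
    omega
  have h2 := G.chainEdges_eq_sum l
  rw [Finset.sum_congr rfl h1] at h2
  have := h l hl hm
  simp at h2
  omega

theorem sum_optAdj_eq_card (l : List V) (hl : l.Nodup) (a : V) :
    ∑ i ∈ Finset.range l.length, G.optAdj (some a) l[i]? =
      (l.toFinset.filter (fun w => G.Adj a w)).card := by
  induction l with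
  | nil => simp
  | cons b l ih =>
    rw [List.length_cons, Finset.sum_range_succ']
    rw [List.nodup_cons] at hl
    simp only [List.getElem?_cons_succ, List.getElem?_cons_zero, ih hl.2, List.toFinset_cons,
      Finset.filter_insert, optAdj_some]
    split_ifs with h
    · rw [Finset.card_insert_of_notMem (by simp [hl.1])]
    · simp

/-- Ore's exchange: reversing the first `i + 1` vertices trades the pair `l[i], l[i+1]` for `a,
l[i+1]` and makes `l[i], b` the closing pair. By `ChainsLT.cyclic`, `[a ~ l[i+1]] + [b ~ l[i]] ≤
[l[i] ~ l[i+1]]`; summing over `i` bounds the degree sum by `chainEdges l`. -/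
theorem ChainsLT.card_adj_add_lt [Fintype V] {k : ℕ} (h : G.ChainsLT k) {l : List V}
    (hl : l.Nodup) (hm : ∀ v, v ∈ l) (hk : k + 1 ≤ l.length) {a b : V} (ha : l.head? = some a)
    (hb : l.getLast? = some b) (hkl : k ≤ G.chainEdges l + 1) :
    (Finset.univ.filter (fun w => G.Adj a w)).card +
      (Finset.univ.filter (fun w => G.Adj b w)).card < k := by
  have hu : l.toFinset = Finset.univ := by ext; simp [hm]
  obtain ⟨m, hlen⟩ : ∃ m, l.length = m + 1 := ⟨l.length - 1, by omega⟩
  have h0 : l[0]? = some a := by rw [← ha, List.head?_eq_getElem?]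
  have h1 : l[m]? = some b := by rw [← hb, List.getLast?_eq_getElem?, hlen]; rfl
  have ea := sum_optAdj_eq_card (G := G) l hl a
  have eb := sum_optAdj_eq_card (G := G) l hl b
  rw [hu, hlen] at ea eb
  rw [Finset.sum_range_succ', h0, optAdj_some, if_neg (G.irrefl), add_zero] at ea
  rw [Finset.sum_range_succ, h1, optAdj_some, if_neg (G.irrefl), add_zero] at eb
  rw [← ea, ← eb, ← Finset.sum_add_distrib]
  have hc := h l hl hm
  refine lt_of_le_of_lt ?_ hc
  rw [chainEdges_eq_sum, hlen, Nat.add_sub_cancel]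
  refine Finset.sum_le_sum fun i hi => ?_
  have hi' : i + 1 < l.length := by simp at hi; omega
  have hf := G.chainEdges_flip l hi'
  have hp : ((l.take (i + 1)).reverse ++ l.drop (i + 1)).Perm l := by
    have := (List.reverse_perm (l.take (i + 1))).append_right (l.drop (i + 1))
    rwa [List.take_append_drop] at this
  have hcyc := h.cyclic (hp.nodup_iff.2 hl) (fun v => hp.mem_iff.2 (hm v)) (by
    rw [hp.length_eq]; exact hk)
  have e1 : ((l.take (i + 1)).reverse ++ l.drop (i + 1)).getLast? = some b := by
    rw [List.getLast?_append, List.getLast?_drop, if_neg (by omega), hb]; rfl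
  have e2 : ((l.take (i + 1)).reverse ++ l.drop (i + 1)).head? = l[i]? := by
    rw [List.head?_append, List.head?_reverse, List.getLast?_take]
    simp [List.getElem?_eq_getElem (show i < l.length by omega)]
  rw [e1, e2] at hcyc
  rw [ha] at hf
  omega

theorem optAdj_sup_edge (u v : V) (o o' : Option V) (h : o ≠ some u ∧ o' ≠ some u) :
    (G ⊔ edge u v).optAdj o o' = G.optAdj o o' := by
  cases o <;> cases o' <;> simp only [optAdj]
  simp only [ne_eq, Option.some.injEq] at h
  simp [edge_adj, h.1, h.2]

theorem chainEdges_sup_edge (u v : V) (l : List V) (h : u ∉ l) :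
    (G ⊔ edge u v).chainEdges l = G.chainEdges l := by
  induction l with
  | nil => rfl
  | cons a l ih =>
    simp only [List.mem_cons, not_or] at h
    rw [chainEdges, chainEdges, ih h.2, optAdj_sup_edge]
    refine ⟨by simpa using Ne.symm h.1, fun hh => h.2 (List.mem_of_head? hh)⟩

theorem chainEdges_sup_edge' (u v : V) (l : List V) (h : v ∉ l) :
    (G ⊔ edge u v).chainEdges l = G.chainEdges l := by
  rw [edge_comm]; exact chainEdges_sup_edge v u l h

theorem chainEdges_sup_edge_eq_or (u v : V) (l : List V) :
    (G ⊔ edge u v).chainEdges l = G.chainEdges l ∨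
      ∃ A B, l = A ++ u :: v :: B ∨ l = A ++ v :: u :: B := by
  induction l with
  | nil => left; rfl
  | cons a l ih =>
    rcases ih with ih | ⟨A, B, h⟩
    · cases l with
      | nil => left; simp [chainEdges]
      | cons b l =>
        by_cases h : (a = u ∧ b = v) ∨ (a = v ∧ b = u)
        · right
          refine ⟨[], l, ?_⟩
          rcases h with ⟨rfl, rfl⟩ | ⟨rfl, rfl⟩ <;> simp
        · left
          rw [chainEdges, ih, chainEdges.eq_2 G a]
          simp only [List.head?_cons, optAdj_some, sup_adj, edge_adj]
          have : ((u = a ∧ v = b ∨ u = b ∧ v = a) ∧ a ≠ b) = False := by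
            grind
          grind
    · right
      refine ⟨a :: A, B, ?_⟩
      rcases h with h | h <;> simp [h]

/-- An ordering that becomes too good must have `u`, `v` consecutive; rotating it to cut there makes
them the ends and loses only the new edge. -/
theorem exists_chain_of_sup_edge {k : ℕ} {u v : V} (h : G.ChainsLT k)
    (h' : ¬ (G ⊔ edge u v).ChainsLT k) :
    ∃ l : List V, l.Nodup ∧ (∀ w, w ∈ l) ∧ k ≤ G.chainEdges l + 1 ∧
      ((l.head? = some u ∧ l.getLast? = some v) ∨ (l.head? = some v ∧ l.getLast? = some u)) := by
  simp only [ChainsLT, not_forall, not_lt] at h'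
  obtain ⟨l, hl, hm, hk⟩ := h'
  have hlt := h l hl hm
  obtain h1 | ⟨A, B, h1⟩ := chainEdges_sup_edge_eq_or (G := G) u v l
  · omega
  have key : ∀ x y : V, ((x = u ∧ y = v) ∨ (x = v ∧ y = u)) → l = A ++ x :: y :: B →
      (y :: B ++ (A ++ [x])).Nodup ∧ (∀ w, w ∈ (y :: B ++ (A ++ [x]))) ∧
      k ≤ G.chainEdges (y :: B ++ (A ++ [x])) + 1 := by
    intro x y hxy hl'
    have e : l = (A ++ [x]) ++ (y :: B) := by simp [hl']
    have hp : (y :: B ++ (A ++ [x])).Perm l := by rw [e]; exact List.perm_append_comm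
    have hd := hp.nodup_iff.2 hl
    refine ⟨hd, fun w => hp.mem_iff.2 (hm w), ?_⟩
    rw [e, chainEdges_append] at hk
    rw [List.nodup_append] at hd
    have hx : x ∉ y :: B := fun hh => hd.2.2 x hh x (by simp) rfl
    have hy : y ∉ A ++ [x] := fun hh => hd.2.2 y (by simp) y hh rfl
    have h2 := (G ⊔ edge u v).optAdj_le_one (A ++ [x]).getLast? (y :: B).head?
    have e1 : (G ⊔ edge u v).chainEdges (A ++ [x]) = G.chainEdges (A ++ [x]) := by
      rcases hxy with ⟨rfl, rfl⟩ | ⟨rfl, rfl⟩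
      · exact chainEdges_sup_edge' _ _ _ hy
      · exact chainEdges_sup_edge _ _ _ hy
    have e2 : (G ⊔ edge u v).chainEdges (y :: B) = G.chainEdges (y :: B) := by
      rcases hxy with ⟨rfl, rfl⟩ | ⟨rfl, rfl⟩
      · exact chainEdges_sup_edge _ _ _ hx
      · exact chainEdges_sup_edge' _ _ _ hx
    rw [chainEdges_append]
    omega
  rcases h1 with h1 | h1
  · obtain ⟨k1, k2, k3⟩ := key u v (by simp) h1
    exact ⟨_, k1, k2, k3, Or.inr (by
      rw [List.getLast?_append]; simp)⟩
  · obtain ⟨k1, k2, k3⟩ := key v u (by simp) h1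
    exact ⟨_, k1, k2, k3, Or.inl (by
      rw [List.getLast?_append]; simp)⟩

theorem length_eq_card [Fintype V] {l : List V} (hl : l.Nodup) (hm : ∀ v, v ∈ l) :
    l.length = Fintype.card V := by
  rw [← List.toFinset_card_of_nodup hl, show l.toFinset = Finset.univ by ext; simp [hm],
    Finset.card_univ]

/-- A Chvátal-type degree condition for graphs without a spanning linear forest with `k` edges. -/
theorem ChainsLT.exists_degrees [Fintype V] {k : ℕ} (h : G.ChainsLT k) (hk : 1 ≤ k)
    (hn : k + 1 ≤ Fintype.card V) :
    ∃ r, 2 * r + 1 ≤ k ∧ ∃ R A : Finset V, R ⊆ A ∧ R.card = r ∧ A.card = k - r ∧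
      (∀ v ∉ A, (Finset.univ.filter (fun w => G.Adj v w)).card ≤ r) ∧
      (∀ v ∉ R, (Finset.univ.filter (fun w => G.Adj v w)).card ≤ k - r - 1) := by
  obtain ⟨G', hGG', hmax⟩ := (Set.toFinite {G' : SimpleGraph V | G'.ChainsLT k}).exists_le_maximal h
  have hG' : G'.ChainsLT k := hmax.prop
  set d : V → ℕ := fun v => (Finset.univ.filter (fun w => G'.Adj v w)).card with hd
  have hdle : ∀ v, (Finset.univ.filter (fun w => G.Adj v w)).card ≤ d v := fun v =>
    Finset.card_le_card (Finset.monotone_filter_right _ (fun w _ hw => hGG' hw))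
  have hsum : ∀ u v, u ≠ v → ¬ G'.Adj u v → d u + d v < k := by
    intro u v huv hadj
    have hn' : ¬ (G' ⊔ edge u v).ChainsLT k := by
      intro hc
      have := hmax.le_of_ge hc le_sup_left
      exact hadj (this (by simp [edge_adj, huv]))
    obtain ⟨l, hl, hm, hkl, ⟨h1, h2⟩ | ⟨h1, h2⟩⟩ := exists_chain_of_sup_edge hG' hn'
    · exact hG'.card_adj_add_lt hl hm (by rw [length_eq_card hl hm]; exact hn) h1 h2 hkl
    · rw [add_comm]
      exact hG'.card_adj_add_lt hl hm (by rw [length_eq_card hl hm]; exact hn) h1 h2 hkl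
  -- A complete graph would give `n - 1 ≥ k` adjacent pairs in any ordering.
  have hex : ∃ p : V × V, p.1 ≠ p.2 ∧ ¬ G'.Adj p.1 p.2 := by
    by_contra hc
    push Not at hc
    have hl := (Finset.univ : Finset V).nodup_toList
    have hm : ∀ v, v ∈ (Finset.univ : Finset V).toList := by simp
    have h1 := hG' _ hl hm
    rw [chainEdges_eq_sum, Finset.sum_congr rfl (g := fun _ => 1)] at h1
    · simp at h1; omega
    · intro i hi
      have hi' : i + 1 < (Finset.univ : Finset V).toList.length := by
        rw [Finset.mem_range] at hi; omega
      rw [List.getElem?_eq_getElem hi', List.getElem?_eq_getElem (by omega), optAdj_some, if_pos]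
      refine hc (_, _) ?_
      simp only [ne_eq, hl.getElem_inj_iff]
      omega
  obtain ⟨⟨u, v⟩, hp, hpmax⟩ := (Finset.univ.filter
    (fun p : V × V => p.1 ≠ p.2 ∧ ¬ G'.Adj p.1 p.2)).exists_max_image
      (fun p => d p.1 + d p.2) (by obtain ⟨p, hp⟩ := hex; exact ⟨p, by simpa using hp⟩)
  simp only [Finset.mem_filter, Finset.mem_univ, true_and] at hp hpmax
  wlog hle : d u ≤ d v generalizing u v
  · refine this v u ⟨hp.1.symm, fun hh => hp.2 hh.symm⟩ (fun b hb => ?_) (by omega)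
    have : d b.1 + d b.2 ≤ d u + d v := hpmax b hb
    change d b.1 + d b.2 ≤ d v + d u
    omega
  have hlt := hsum u v hp.1 hp.2
  have hcompl : ∀ x, (Finset.univ.filter (fun w => ¬ G'.Adj x w)).card = Fintype.card V - d x := by
    intro x
    rw [show Finset.univ.filter (fun w => ¬ G'.Adj x w) =
      (Finset.univ.filter (fun w => G'.Adj x w))ᶜ by ext; simp, Finset.card_compl]
  -- By maximality of the degree sum, a non-neighbour of `u` has degree at most `d v ≤ k - d u - 1`,
  -- and a non-neighbour of `v` other than `v` has degree at most `d u`.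
  have hM : Finset.univ.filter (fun w => ¬ G'.Adj u w) ⊆
      Finset.univ.filter (fun w => d w ≤ k - d u - 1) := by
    intro w hw
    simp only [Finset.mem_filter, Finset.mem_univ, true_and] at hw ⊢
    by_cases hwu : w = u
    · subst hwu; omega
    · have := hpmax (u, w) ⟨fun hh => hwu hh.symm, hw⟩
      simp only at this
      omega
  have hL : (Finset.univ.filter (fun w => ¬ G'.Adj v w)).erase v ⊆
      Finset.univ.filter (fun w => d w ≤ d u) := by
    intro w hw
    simp only [Finset.mem_filter, Finset.mem_univ, true_and, Finset.mem_erase] at hw ⊢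
    have := hpmax (w, v) ⟨hw.1, fun hh => hw.2 hh.symm⟩
    simp only at this
    omega
  have hMc := Finset.card_le_card hM
  have hLc := Finset.card_le_card hL
  rw [Finset.card_erase_of_mem (by simp), hcompl] at hLc
  rw [hcompl] at hMc
  -- Trim the low-degree sets to exact sizes, nested as `L ⊆ M`, so that their complements `A = Lᶜ`
  -- and `R = Mᶜ` satisfy `R ⊆ A`.
  obtain ⟨L, hL1, hL2⟩ := Finset.exists_subset_card_eq
    (show Fintype.card V - (k - d u) ≤ (Finset.univ.filter (fun w => d w ≤ d u)).card by omega)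
  obtain ⟨M, hM1, hM2, hM3⟩ := Finset.exists_subsuperset_card_eq
    (hL1.trans (show Finset.univ.filter (fun w => d w ≤ d u) ⊆
      Finset.univ.filter (fun w => d w ≤ k - d u - 1) from
        Finset.monotone_filter_right _ (fun w _ hw => by
          have : d w ≤ d u := hw
          omega)))
    (show L.card ≤ Fintype.card V - d u by omega) hMc
  refine ⟨d u, by omega, Mᶜ, Lᶜ, Finset.compl_subset_compl.2 hM1, ?_, ?_, ?_, ?_⟩
  · rw [Finset.card_compl]; omega
  · rw [Finset.card_compl]; omega
  · intro x hx
    have := hL1 (by simpa using hx)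
    exact (hdle x).trans (by simpa using this)
  · intro x hx
    have := hM2 (by simpa using hx)
    exact (hdle x).trans (by simpa using this)

end SimpleGraph

/-! ### Linear forests and vertex orderings. -/

namespace SimpleGraph
open scoped Classical

/-- The linear forest on `Fin n` with the edges `{j, j + 1}` for `j ∈ J`. -/
def intervalForest (n : ℕ) (J : Finset ℕ) : SimpleGraph (Fin n) where
  Adj a b := (a.val + 1 = b.val ∧ a.val ∈ J) ∨ (b.val + 1 = a.val ∧ b.val ∈ J)
  symm := ⟨fun _ _ h => h.symm⟩
  loopless := ⟨fun a h => by omega⟩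

theorem intervalForest_adj {n : ℕ} {J : Finset ℕ} {a b : Fin n} :
    (intervalForest n J).Adj a b ↔
      (a.val + 1 = b.val ∧ a.val ∈ J) ∨ (b.val + 1 = a.val ∧ b.val ∈ J) := Iff.rfl

theorem mem_of_reachable_intervalForest {n : ℕ} {J : Finset ℕ} {a b : Fin n}
    (h : (intervalForest n J).Reachable a b) (hab : a < b) : a.val ∈ J := by
  by_contra hJ
  obtain ⟨w⟩ := h
  have key : ∀ {x y : Fin n}, (intervalForest n J).Walk x y → x ≤ a → y ≤ a := by
    intro x y w
    induction w with
    | nil => exact id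
    | cons hadj _ ih =>
      intro hx
      refine ih ?_
      rw [intervalForest_adj] at hadj
      rw [Fin.le_def] at *
      rcases hadj with ⟨h1, h2⟩ | ⟨h1, h2⟩
      · have : ∀ {c : ℕ}, c ∈ J → c ≠ a.val := fun hc he => hJ (he ▸ hc)
        have := this h2
        omega
      · omega
  exact absurd (key w le_rfl) (not_le.2 hab)

theorem intervalForest_isLinearForest (n : ℕ) (J : Finset ℕ) :
    (intervalForest n J).IsLinearForest := by
  intro c
  let e : Fin (Fintype.card c.supp) ≃o c.supp := Fintype.orderIsoFinOfCardEq _ rfl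
  refine ⟨Fintype.card c.supp, ⟨RelIso.symm ⟨e.toEquiv, ?_⟩⟩⟩
  intro i j
  -- A component is an interval of `Fin n`, so covering inside it is succession; its graph is thus
  -- the Hasse diagram of a finite chain, which is `pathGraph`.
  have key : ∀ x y : c.supp, x ⋖ y ↔ (x.1.val + 1 = y.1.val ∧ x.1.val ∈ J) := by
    intro x y
    constructor
    · intro h
      have hr : (intervalForest n J).Reachable x.1 y.1 :=
        ConnectedComponent.exact (x.2.trans y.2.symm)
      have hxy : x.1 < y.1 := h.lt
      have hJ := mem_of_reachable_intervalForest hr hxy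
      refine ⟨?_, hJ⟩
      have hlt : x.1.val + 1 < n := lt_of_le_of_lt (Nat.succ_le_of_lt hxy) y.1.isLt
      have hz : (⟨x.1.val + 1, hlt⟩ : Fin n) ∈ c.supp := by
        refine c.mem_supp_of_adj_mem_supp x.2 ?_
        rw [intervalForest_adj]
        exact Or.inl ⟨rfl, hJ⟩
      by_contra hne
      refine h.2 (c := ⟨_, hz⟩) ?_ ?_
      · exact Fin.lt_def.2 (Nat.lt_succ_self _)
      · refine Fin.lt_def.2 ?_
        have : x.1.val < y.1.val := hxy
        change x.1.val + 1 < y.1.val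
        omega
    · rintro ⟨h1, -⟩
      refine ⟨Fin.lt_def.2 (by omega), fun z hz1 hz2 => ?_⟩
      have hz1' : x.1.val < z.1.val := hz1
      have hz2' : z.1.val < y.1.val := hz2
      omega
  change (intervalForest n J).Adj (e i).1 (e j).1 ↔ (pathGraph _).Adj i j
  rw [intervalForest_adj, ← key, ← key, pathGraph, hasse_adj]
  simp

theorem intervalForest_ncard_edgeSet {n : ℕ} {J : Finset ℕ} (hJ : ∀ j ∈ J, j + 1 < n) :
    (intervalForest n J).edgeSet.ncard = J.card := by
  rw [← Set.ncard_coe_finset]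
  symm
  refine Set.ncard_congr (fun j hj => s(⟨j, by have := hJ j hj; omega⟩, ⟨j + 1, hJ j hj⟩)) ?_ ?_ ?_
  · intro j hj
    rw [mem_edgeSet, intervalForest_adj]
    exact Or.inl ⟨rfl, hj⟩
  · intro a b ha hb h
    simp only [Sym2.eq_iff, Fin.mk.injEq] at h
    omega
  · intro z
    induction z with
    | h a b =>
      intro h
      rw [mem_edgeSet, intervalForest_adj] at h
      rcases h with ⟨h1, h2⟩ | ⟨h1, h2⟩
      · refine ⟨a.val, h2, ?_⟩
        rw [Sym2.eq_iff]; left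
        exact ⟨rfl, Fin.ext h1⟩
      · refine ⟨b.val, h2, ?_⟩
        rw [Sym2.eq_iff]; right
        exact ⟨rfl, Fin.ext h1⟩

/-- Keeping exactly `k` of the adjacent consecutive positions of a good ordering embeds an
`intervalForest` with `k` edges. -/
theorem FamilyFree.chainsLT {n k : ℕ} {G : SimpleGraph (Fin n)}
    (h : FamilyFree (linearForests n k) G) : G.ChainsLT k := by
  intro l hl hm
  by_contra hk
  rw [not_lt, chainEdges_eq_sum] at hk
  have hlen : l.length = n := by simpa using length_eq_card hl hm
  have h1 : ∑ i ∈ Finset.range (l.length - 1), G.optAdj l[i]? l[i + 1]? =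
      ((Finset.range (l.length - 1)).filter (fun i => G.optAdj l[i]? l[i + 1]? = 1)).card := by
    rw [Finset.card_filter]
    refine Finset.sum_congr rfl fun i _ => ?_
    have := G.optAdj_le_one l[i]? l[i + 1]?
    split_ifs <;> omega
  rw [h1] at hk
  obtain ⟨J, hJ, hJk⟩ := Finset.exists_subset_card_eq hk
  have hJn : ∀ j ∈ J, j + 1 < n := by
    intro j hj
    have := hJ hj
    simp only [Finset.mem_filter, Finset.mem_range] at this
    omega
  have hadj : ∀ j (hj : j ∈ J), G.Adj (l[j]'(by have := hJn j hj; omega))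
      (l[j + 1]'(by have := hJn j hj; omega)) := by
    intro j hj
    have h2 := (Finset.mem_filter.1 (hJ hj)).2
    have h3 := hJn j hj
    rw [List.getElem?_eq_getElem (by omega), List.getElem?_eq_getElem (by omega), optAdj_some] at h2
    by_contra hc
    simp [hc] at h2
  refine h (intervalForest n J) ⟨intervalForest_isLinearForest n J,
    (intervalForest_ncard_edgeSet hJn).trans hJk⟩ ?_
  refine ⟨⟨⟨fun i => l[i.val]'(by omega), ?_⟩, ?_⟩⟩
  · intro a b hab
    rw [intervalForest_adj] at hab
    rcases hab with ⟨h2, h3⟩ | ⟨h2, h3⟩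
    · have := hadj a h3
      simpa only [h2] using this
    · have := (hadj b h3).symm
      simpa only [h2] using this
  · intro a b hab
    exact Fin.ext ((hl.getElem_inj_iff).1 hab)

/-- Orient each edge by increasing position `φ` in its path: in- and out-degrees are then at most
one. -/
theorem IsLinearForest.exists_orientation {V : Type*} [Fintype V] {F : SimpleGraph V}
    (h : F.IsLinearForest) :
    ∃ (E : Finset (V × V)) (φ : V → ℕ), F.edgeSet.ncard ≤ E.card ∧
      (∀ e ∈ E, F.Adj e.1 e.2 ∧ φ e.2 = φ e.1 + 1) ∧
      Set.InjOn Prod.fst (E : Set (V × V)) ∧ Set.InjOn Prod.snd (E : Set (V × V)) := by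
  choose m f using h
  let g := fun c => (f c).some
  let φ : V → ℕ := fun v => (g (F.connectedComponentMk v) ⟨v, rfl⟩).val
  have hφ : ∀ (c) (v : c.supp), φ v.1 = (g c v).val := by
    rintro c ⟨v, rfl⟩; rfl
  have hadj : ∀ a b, F.Adj a b → φ b = φ a + 1 ∨ φ a = φ b + 1 := by
    intro a b hab
    let c := F.connectedComponentMk a
    have ha : a ∈ c.supp := rfl
    have hb : b ∈ c.supp := c.mem_supp_of_adj_mem_supp ha hab
    have h1 : c.toSimpleGraph.Adj ⟨a, ha⟩ ⟨b, hb⟩ := hab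
    have h2 := (g c).map_rel_iff.2 h1
    rw [pathGraph_adj] at h2
    have e1 := hφ c ⟨a, ha⟩
    have e2 := hφ c ⟨b, hb⟩
    simp only at e1 e2
    rw [e1, e2]
    rcases h2 with h2 | h2
    · exact Or.inl h2.symm
    · exact Or.inr h2.symm
  have hinj : ∀ a b, F.Reachable a b → φ a = φ b → a = b := by
    intro a b hab hh
    let c := F.connectedComponentMk a
    have ha : a ∈ c.supp := rfl
    have hb : b ∈ c.supp := (ConnectedComponent.sound hab).symm
    have e1 := hφ c ⟨a, ha⟩
    have e2 := hφ c ⟨b, hb⟩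
    simp only at e1 e2
    have := (g c).injective (Fin.ext (e1.symm.trans (hh.trans e2)))
    simpa using this
  refine ⟨Finset.univ.filter (fun e => F.Adj e.1 e.2 ∧ φ e.2 = φ e.1 + 1), φ, ?_, ?_, ?_, ?_⟩
  · rw [← Set.ncard_coe_finset]
    refine (Set.ncard_le_ncard (t := (fun e : V × V => s(e.1, e.2)) '' _) ?_
      (Set.toFinite _)).trans (Set.ncard_image_le (Set.toFinite _))
    intro z
    induction z with
    | h a b =>
      intro hab
      rw [mem_edgeSet] at hab
      rcases hadj a b hab with h1 | h1
      · exact ⟨(a, b), by simp [hab, h1], rfl⟩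
      · exact ⟨(b, a), by simp [hab.symm, h1], Sym2.eq_swap⟩
  · intro e he
    simpa using he
  · rintro ⟨a, b⟩ h1 ⟨a', b'⟩ h2 (rfl : a = a')
    simp only [Finset.coe_filter, Finset.mem_univ, true_and, Set.mem_ofPred_eq] at h1 h2
    have := hinj b b' (h1.1.symm.reachable.trans h2.1.reachable) (by omega)
    rw [this]
  · rintro ⟨a, b⟩ h1 ⟨a', b'⟩ h2 (rfl : b = b')
    simp only [Finset.coe_filter, Finset.mem_univ, true_and, Set.mem_ofPred_eq] at h1 h2
    have := hinj a a' (h1.1.reachable.trans h2.1.symm.reachable) (by omega)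
    rw [this]

theorem IsLinearForest.ncard_edgeSet_lt {V : Type*} [Fintype V] {F : SimpleGraph V}
    (h : F.IsLinearForest) {k : ℕ} (R B : Finset V) (hB : 2 * R.card + B.card ≤ k)
    (hR : 2 * R.card + 1 ≤ k)
    (hF : ∀ a b, F.Adj a b → a ∈ R ∨ b ∈ R ∨ (a ∈ B ∧ b ∈ B)) : F.edgeSet.ncard < k := by
  obtain ⟨E, φ, hE, hadj, hfst, hsnd⟩ := h.exists_orientation
  have h1 : (E.filter (fun e => e.1 ∈ R)).card ≤ R.card :=
    Finset.card_le_card_of_injOn Prod.fst (fun e he => (Finset.mem_filter.1 he).2)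
      (hfst.mono (Finset.coe_subset.2 (Finset.filter_subset _ _)))
  have h2 : (E.filter (fun e => e.2 ∈ R)).card ≤ R.card :=
    Finset.card_le_card_of_injOn Prod.snd (fun e he => (Finset.mem_filter.1 he).2)
      (hsnd.mono (Finset.coe_subset.2 (Finset.filter_subset _ _)))
  -- The `φ`-least vertex of `B` is the head of no edge inside `B`. For empty `B` nothing is gained,
  -- and `hR` supplies the strict inequality.
  have h3 : (E.filter (fun e => e.1 ∈ B ∧ e.2 ∈ B)).card ≤ B.card - 1 := by
    rcases B.eq_empty_or_nonempty with rfl | hne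
    · simp
    · obtain ⟨x, hx, hmin⟩ := B.exists_min_image φ hne
      rw [← Finset.card_erase_of_mem hx]
      refine Finset.card_le_card_of_injOn Prod.snd (fun e he => ?_) (hsnd.mono (Finset.coe_subset.2 (Finset.filter_subset _ _)))
      have he := Finset.mem_filter.1 he
      rw [Finset.mem_coe, Finset.mem_erase]
      refine ⟨fun hh => ?_, he.2.2⟩
      have h4 := hmin _ he.2.1
      have h5 := (hadj e he.1).2
      rw [hh] at h5
      omega
  have h4 : E ⊆ (E.filter (fun e => e.1 ∈ R) ∪ E.filter (fun e => e.2 ∈ R)) ∪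
      E.filter (fun e => e.1 ∈ B ∧ e.2 ∈ B) := by
    intro e he
    have := hF _ _ (hadj e he).1
    simp only [Finset.mem_union, Finset.mem_filter]
    tauto
  have h5 := Finset.card_le_card h4
  have h6 := Finset.card_union_le (E.filter (fun e => e.1 ∈ R) ∪ E.filter (fun e => e.2 ∈ R))
    (E.filter (fun e => e.1 ∈ B ∧ e.2 ∈ B))
  have h7 := Finset.card_union_le (E.filter (fun e => e.1 ∈ R)) (E.filter (fun e => e.2 ∈ R))
  omega

theorem familyFree_linearForests {V : Type*} {n k : ℕ} {G : SimpleGraph V} 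
    (R B : Finset V) (hB : 2 * R.card + B.card ≤ k) (hR : 2 * R.card + 1 ≤ k)
    (hG : ∀ a b, G.Adj a b → a ∈ R ∨ b ∈ R ∨ (a ∈ B ∧ b ∈ B)) :
    FamilyFree (linearForests n k) G := by
  rintro F ⟨hF, hFk⟩ ⟨f⟩
  have hc : ∀ S : Finset V, (Finset.univ.filter (fun x => f x ∈ S)).card ≤ S.card := fun S =>
    Finset.card_le_card_of_injOn f (fun x hx => (Finset.mem_filter.1 hx).2) f.injective.injOn
  have h1 := hc R
  have h2 := hc B
  refine absurd hFk (ne_of_lt (hF.ncard_edgeSet_lt (Finset.univ.filter (fun x => f x ∈ R))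
    (Finset.univ.filter (fun x => f x ∈ B)) (by omega) (by omega) ?_))
  intro a b hab
  simpa using hG _ _ (f.toHom.map_adj hab)

end SimpleGraph

/-! ### Copies as cliques with common neighbours. -/

namespace SimpleGraph
open scoped Classical

variable {V : Type*} [Fintype V] {G : SimpleGraph V}

/-- The common neighbours of a set of vertices. -/
noncomputable def commonNbrs (G : SimpleGraph V) (S : Finset V) : Finset V :=
  Finset.univ.filter (fun w => ∀ v ∈ S, G.Adj v w)

theorem mem_commonNbrs {S : Finset V} {w : V} : w ∈ G.commonNbrs S ↔ ∀ v ∈ S, G.Adj v w := by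
  simp [commonNbrs]

theorem disjoint_commonNbrs (S : Finset V) : Disjoint S (G.commonNbrs S) :=
  Finset.disjoint_left.2 fun v hv hw => G.irrefl (mem_commonNbrs.1 hw v hv)

theorem cliqueBipartite_adj {s t : ℕ} {x y : Fin s ⊕ Fin t} :
    (cliqueBipartite s t).Adj x y ↔ x ≠ y ∧ (x.isLeft ∨ y.isLeft) := by
  rcases x with x | x <;> rcases y with y | y <;> simp [cliqueBipartite]

/-- The subgraph on `S ∪ T` with the edges of `G` that meet `S`. -/
def meetingSubgraph (G : SimpleGraph V) (S T : Finset V) : G.Subgraph where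
  verts := {v | v ∈ S ∨ v ∈ T}
  Adj a b := G.Adj a b ∧ (a ∈ S ∨ a ∈ T) ∧ (b ∈ S ∨ b ∈ T) ∧ (a ∈ S ∨ b ∈ S)
  adj_sub h := h.1
  edge_vert h := h.2.1
  symm := ⟨fun _ _ h => ⟨h.1.symm, h.2.2.1, h.2.1, h.2.2.2.symm⟩⟩

theorem meetingSubgraph_iso {s t : ℕ} {S T : Finset V} (hS : G.IsNClique s S)
    (hT : T ⊆ G.commonNbrs S) (hTc : T.card = t) :
    Nonempty (cliqueBipartite s t ≃g (G.meetingSubgraph S T).coe) := by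
  have hd : Disjoint S T := (disjoint_commonNbrs S).mono_right hT
  let eS := S.equivFinOfCardEq hS.card_eq
  let eT := T.equivFinOfCardEq hTc
  let g : Fin s ⊕ Fin t → V := Sum.elim (fun i => (eS.symm i).1) (fun i => (eT.symm i).1)
  have hgl : ∀ x, g x ∈ S ↔ x.isLeft := by
    rintro (i | i)
    · simp [g]
    · simpa [g] using Finset.disjoint_right.1 hd (eT.symm i).2
  have hgr : ∀ x, g x ∈ T ↔ ¬ x.isLeft := by
    rintro (i | i)
    · simpa [g] using Finset.disjoint_left.1 hd (eS.symm i).2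
    · simp [g]
  have hinj : Function.Injective g := by
    intro x y hxy
    have h1 := hgl x
    have h2 := hgl y
    rw [hxy, h2] at h1
    rcases x with x | x <;> rcases y with y | y <;> simp [g] at h1 hxy ⊢
    · exact hxy
    · exact hxy
  have hmem : ∀ x, g x ∈ S ∨ g x ∈ T := by
    intro x; rw [hgl, hgr]; exact em _
  let e : (Fin s ⊕ Fin t) ≃ (G.meetingSubgraph S T).verts :=
    Equiv.ofBijective (fun x => ⟨g x, hmem x⟩) ⟨fun x y h => hinj (congrArg Subtype.val h), by
      rintro ⟨v, hv | hv⟩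
      · exact ⟨Sum.inl (eS ⟨v, hv⟩), by simp [g]⟩
      · exact ⟨Sum.inr (eT ⟨v, hv⟩), by simp [g]⟩⟩
  refine ⟨⟨e, ?_⟩⟩
  intro x y
  change (G.Adj (g x) (g y) ∧ (g x ∈ S ∨ g x ∈ T) ∧ (g y ∈ S ∨ g y ∈ T) ∧
    (g x ∈ S ∨ g y ∈ S)) ↔ _
  rw [cliqueBipartite_adj, ← hgl, ← hgl]
  constructor
  · rintro ⟨h1, -, -, h2⟩
    exact ⟨fun h => h1.ne (congrArg g h), h2⟩
  · rintro ⟨h1, h2⟩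
    have hne : g x ≠ g y := hinj.ne h1
    refine ⟨?_, hmem x, hmem y, h2⟩
    rcases hmem x with hx | hx <;> rcases hmem y with hy | hy
    · exact hS.isClique hx hy hne
    · exact mem_commonNbrs.1 (hT hy) _ hx
    · exact (mem_commonNbrs.1 (hT hx) _ hy).symm
    · exact absurd h2 (by
        simp [Finset.disjoint_right.1 hd hx, Finset.disjoint_right.1 hd hy])

theorem exists_meetingSubgraph_eq {s t : ℕ} {G' : G.Subgraph}
    (f : cliqueBipartite s t ≃g G'.coe) :
    ∃ S T, G.IsNClique s S ∧ T ⊆ G.commonNbrs S ∧ T.card = t ∧ G.meetingSubgraph S T = G' := by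
  let g : Fin s ⊕ Fin t → V := fun x => (f x).1
  have hg : Function.Injective g := Subtype.val_injective.comp f.injective
  have hadj : ∀ x y, G'.Adj (g x) (g y) ↔ x ≠ y ∧ (x.isLeft ∨ y.isLeft) := by
    intro x y
    rw [← cliqueBipartite_adj, ← f.map_rel_iff]; rfl
  have hsurj : ∀ v ∈ G'.verts, ∃ x, g x = v := by
    intro v hv
    obtain ⟨x, hx⟩ := f.surjective ⟨v, hv⟩
    exact ⟨x, congrArg Subtype.val hx⟩
  let S : Finset V := Finset.univ.image (fun i : Fin s => g (Sum.inl i))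
  let T : Finset V := Finset.univ.image (fun i : Fin t => g (Sum.inr i))
  have hST : ∀ x, g x ∈ S ∨ g x ∈ T := by
    rintro (i | i)
    · left; exact Finset.mem_image_of_mem _ (Finset.mem_univ _)
    · right; exact Finset.mem_image_of_mem (fun i : Fin t => g (Sum.inr i)) (Finset.mem_univ _)
  have hSl : ∀ x, g x ∈ S ↔ x.isLeft := by
    rintro (i | i)
    · simp [S]
    · simp [S, hg.eq_iff]
  have hTv : ∀ v, v ∈ S ∨ v ∈ T → ∃ x, g x = v := by
    intro v hv
    simp only [S, T, Finset.mem_image, Finset.mem_univ, true_and] at hv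
    rcases hv with ⟨i, hi⟩ | ⟨i, hi⟩ <;> exact ⟨_, hi⟩
  refine ⟨S, T, ⟨?_, ?_⟩, ?_, ?_, ?_⟩
  · intro a ha b hb hab
    obtain ⟨x, rfl⟩ := hTv a (Or.inl ha)
    obtain ⟨y, rfl⟩ := hTv b (Or.inl hb)
    exact G'.adj_sub ((hadj x y).2 ⟨fun h => hab (congrArg g h), Or.inl ((hSl x).1 ha)⟩)
  · exact (Finset.card_image_of_injective _ (hg.comp Sum.inl_injective)).trans (by simp)
  · intro w hw
    rw [mem_commonNbrs]
    intro v hv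
    obtain ⟨x, rfl⟩ := hTv v (Or.inl hv)
    obtain ⟨i, -, rfl⟩ := Finset.mem_image.1 hw
    have hx := (hSl x).1 hv
    refine G'.adj_sub ((hadj _ _).2 ⟨?_, Or.inl hx⟩)
    rintro rfl
    simp at hx
  · exact (Finset.card_image_of_injective _ (hg.comp Sum.inr_injective)).trans (by simp)
  · ext a b
    · change (a ∈ S ∨ a ∈ T) ↔ _
      constructor
      · intro h
        obtain ⟨x, rfl⟩ := hTv a h
        exact (f x).2
      · intro h
        obtain ⟨x, rfl⟩ := hsurj a h
        exact hST x
    · change (G.Adj a b ∧ (a ∈ S ∨ a ∈ T) ∧ (b ∈ S ∨ b ∈ T) ∧ (a ∈ S ∨ b ∈ S)) ↔ _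
      constructor
      · rintro ⟨h1, h2, h3, h4⟩
        obtain ⟨x, rfl⟩ := hTv a h2
        obtain ⟨y, rfl⟩ := hTv b h3
        rw [hSl, hSl] at h4
        exact (hadj x y).2 ⟨fun h => h1.ne (congrArg g h), h4⟩
      · intro h
        obtain ⟨x, rfl⟩ := hsurj a (G'.edge_vert h)
        obtain ⟨y, rfl⟩ := hsurj b (G'.edge_vert h.symm)
        refine ⟨G'.adj_sub h, hST x, hST y, ?_⟩
        rw [hSl, hSl]
        exact ((hadj x y).1 h).2

/-- A vertex of `S` outside `S'` would lie in `T'`, next to a second vertex of `T'`: the two are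
joined in the first subgraph but not in the second. Hence a copy determines its clique side. -/
theorem meetingSubgraph_injOn {S T S' T' : Finset V} (hS : G.IsClique S)
    (hT : T ⊆ G.commonNbrs S) (hT' : T' ⊆ G.commonNbrs S') (h2 : 2 ≤ T'.card)
    (h : G.meetingSubgraph S T = G.meetingSubgraph S' T') : S ⊆ S' := by
  have hv : ∀ v, (v ∈ S ∨ v ∈ T) ↔ (v ∈ S' ∨ v ∈ T') := fun v =>
    Set.ext_iff.1 (congrArg Subgraph.verts h) v
  have hd' : Disjoint S' T' := (disjoint_commonNbrs S').mono_right hT'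
  intro v hvS
  by_contra hvS'
  have hvT' : v ∈ T' := ((hv v).1 (Or.inl hvS)).resolve_left hvS'
  obtain ⟨w, hw, hwv⟩ := Finset.exists_mem_ne (show 1 < T'.card by omega) v
  have hwm := (hv w).2 (Or.inr hw)
  have hadj : G.Adj v w := by
    rcases hwm with h3 | h3
    · exact hS hvS h3 hwv.symm
    · exact mem_commonNbrs.1 (hT h3) _ hvS
  have h4 : (G.meetingSubgraph S T).Adj v w := ⟨hadj, Or.inl hvS, hwm, Or.inl hvS⟩
  rw [h] at h4
  rcases h4.2.2.2 with h5 | h5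
  · exact hvS' h5
  · exact Finset.disjoint_left.1 hd' h5 hw

theorem copyCount_cliqueBipartite (G : SimpleGraph V) {s t : ℕ} (ht : 2 ≤ t) :
    G.copyCount (cliqueBipartite s t) =
      ∑ S ∈ G.cliqueFinset s, (G.commonNbrs S).card.choose t := by
  have h1 : ∑ S ∈ G.cliqueFinset s, (G.commonNbrs S).card.choose t =
      ((G.cliqueFinset s).sigma (fun S => (G.commonNbrs S).powersetCard t)).card := by
    rw [Finset.card_sigma]; simp
  rw [h1, ← Finset.card_image_of_injOn (f := fun p => G.meetingSubgraph p.1 p.2), copyCount]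
  · congr 1
    ext G'
    simp only [Finset.mem_filter, Finset.mem_univ, true_and, Finset.mem_image, Finset.mem_sigma,
      mem_cliqueFinset_iff, Finset.mem_powersetCard]
    constructor
    · rintro ⟨f⟩
      obtain ⟨S, T, hS, hT, hTc, h⟩ := exists_meetingSubgraph_eq f
      exact ⟨⟨S, T⟩, ⟨hS, hT, hTc⟩, h⟩
    · rintro ⟨⟨S, T⟩, ⟨hS, hT, hTc⟩, rfl⟩
      exact meetingSubgraph_iso hS hT hTc
  · rintro ⟨S, T⟩ h1 ⟨S', T'⟩ h2 h
    simp only [Finset.coe_sigma, Set.mem_sigma_iff, Finset.mem_coe, mem_cliqueFinset_iff,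
      Finset.mem_powersetCard] at h1 h2 h
    obtain ⟨hS, hT, hTc⟩ := h1
    obtain ⟨hS', hT', hTc'⟩ := h2
    have e : S = S' := Finset.Subset.antisymm
      (meetingSubgraph_injOn hS.isClique hT hT' (by omega) h)
      (meetingSubgraph_injOn hS'.isClique hT' hT (by omega) h.symm)
    subst e
    have hv : ∀ v, (v ∈ S ∨ v ∈ T) ↔ (v ∈ S ∨ v ∈ T') := fun v =>
      Set.ext_iff.1 (congrArg Subgraph.verts h) v
    have d1 : Disjoint S T := (disjoint_commonNbrs S).mono_right hT
    have d2 : Disjoint S T' := (disjoint_commonNbrs S).mono_right hT'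
    have : T = T' := by
      ext v
      have := hv v
      have : v ∈ S → v ∉ T := fun h => Finset.disjoint_left.1 d1 h
      have : v ∈ S → v ∉ T' := fun h => Finset.disjoint_left.1 d2 h
      tauto
    rw [this]

theorem card_commonNbrs_add_le_degree {s : ℕ} {S : Finset V} (hS : G.IsNClique s S) {v : V}
    (hv : v ∈ S) :
    (G.commonNbrs S).card + (s - 1) ≤ (Finset.univ.filter (fun w => G.Adj v w)).card := by
  rw [← hS.card_eq, ← Finset.card_erase_of_mem hv, ← Finset.card_union_of_disjoint
    ((disjoint_commonNbrs S).symm.mono_right (Finset.erase_subset _ _))]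
  refine Finset.card_le_card fun w hw => ?_
  rw [Finset.mem_union, Finset.mem_erase] at hw
  rw [Finset.mem_filter]
  refine ⟨Finset.mem_univ _, ?_⟩
  rcases hw with hw | hw
  · exact mem_commonNbrs.1 hw v hv
  · exact hS.isClique hv hw.2 hw.1.symm

theorem card_commonNbrs_le (S : Finset V) :
    (G.commonNbrs S).card ≤ Fintype.card V - S.card := by
  rw [← Finset.card_compl]
  exact Finset.card_le_card fun w hw =>
    Finset.mem_compl.2 (Finset.disjoint_right.1 (disjoint_commonNbrs S) hw)

/-- A vertex `v ∈ S` of degree at most `d` leaves at most `d - (s - 1)` common neighbours. Use `v ∉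
R` for `S ⊆ A`, and `v ∉ A` otherwise; in the latter case `S.erase v` is also one of at most
`r.choose (s - 1)` subsets of the neighbourhood of `v`. -/
theorem sum_choose_commonNbrs_le {s t n k r : ℕ} (hs : 1 ≤ s) (hn : Fintype.card V = n)
    (hr : r + 1 ≤ k) {R A : Finset V} (hRA : R ⊆ A) (hR : R.card = r) (hA : A.card = k - r)
    (hlow : ∀ v ∉ A, (Finset.univ.filter (fun w => G.Adj v w)).card ≤ r)
    (hmid : ∀ v ∉ R, (Finset.univ.filter (fun w => G.Adj v w)).card ≤ k - r - 1) :
    ∑ S ∈ G.cliqueFinset s, (G.commonNbrs S).card.choose t ≤ splitCopies s t n k r := by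
  rw [← Finset.sum_filter_add_sum_filter_not _ (fun S => S ⊆ A),
    ← Finset.sum_filter_add_sum_filter_not ((G.cliqueFinset s).filter (fun S => S ⊆ A))
      (fun S => S ⊆ R)]
  have h1 : ∑ S ∈ ((G.cliqueFinset s).filter (fun S => S ⊆ A)).filter (fun S => S ⊆ R),
      (G.commonNbrs S).card.choose t ≤ r.choose s * (n - s).choose t := by
    refine (Finset.sum_le_card_nsmul _ _ ((n - s).choose t) fun S hS => ?_).trans ?_
    · simp only [Finset.mem_filter, mem_cliqueFinset_iff] at hS
      have := G.card_commonNbrs_le S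
      rw [hn, hS.1.1.card_eq] at this
      exact Nat.choose_le_choose _ this
    · rw [smul_eq_mul]
      refine Nat.mul_le_mul_right _ ?_
      rw [← hR, ← Finset.card_powersetCard]
      refine Finset.card_le_card fun S hS => ?_
      simp only [Finset.mem_filter, mem_cliqueFinset_iff] at hS
      exact Finset.mem_powersetCard.2 ⟨hS.2, hS.1.1.card_eq⟩
  have h2 : ∑ S ∈ ((G.cliqueFinset s).filter (fun S => S ⊆ A)).filter (fun S => ¬ S ⊆ R),
      (G.commonNbrs S).card.choose t ≤
      ((k - r).choose s - r.choose s) * (k - r - s).choose t := by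
    refine (Finset.sum_le_card_nsmul _ _ ((k - r - s).choose t) fun S hS => ?_).trans ?_
    · simp only [Finset.mem_filter, mem_cliqueFinset_iff] at hS
      obtain ⟨v, hv, hvR⟩ := Finset.not_subset.1 hS.2
      have h3 := card_commonNbrs_add_le_degree hS.1.1 hv
      have h4 := hmid v hvR
      exact Nat.choose_le_choose _ (by omega)
    · rw [smul_eq_mul]
      refine Nat.mul_le_mul_right _ ?_
      rw [← hA, ← hR, ← Finset.card_powersetCard, ← Finset.card_powersetCard,
        ← Finset.card_sdiff_of_subset (Finset.powersetCard_mono hRA)]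
      refine Finset.card_le_card fun S hS => ?_
      simp only [Finset.mem_filter, mem_cliqueFinset_iff] at hS
      simp only [Finset.mem_sdiff, Finset.mem_powersetCard]
      exact ⟨⟨hS.1.2, hS.1.1.card_eq⟩, fun h => hS.2 h.1⟩
  have h3 : ∑ S ∈ (G.cliqueFinset s).filter (fun S => ¬ S ⊆ A), (G.commonNbrs S).card.choose t ≤
      (n - (k - r)) * r.choose (s - 1) * (r + 1 - s).choose t := by
    refine (Finset.sum_le_card_nsmul _ _ ((r + 1 - s).choose t) fun S hS => ?_).trans ?_
    · simp only [Finset.mem_filter, mem_cliqueFinset_iff] at hS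
      obtain ⟨v, hv, hvA⟩ := Finset.not_subset.1 hS.2
      have h3 := card_commonNbrs_add_le_degree hS.1 hv
      have h4 := hlow v hvA
      exact Nat.choose_le_choose _ (by omega)
    · rw [smul_eq_mul]
      refine Nat.mul_le_mul_right _ ?_
      rw [← hn, ← hA, ← Finset.card_compl]
      refine le_trans (Finset.card_le_card (t := Aᶜ.biUnion fun v =>
        ((Finset.univ.filter (fun w => G.Adj v w)).powersetCard (s - 1)).image (insert v))
          fun S hS => ?_) (Finset.card_biUnion_le_card_mul _ _ _ fun v hv => ?_)
      · simp only [Finset.mem_filter, mem_cliqueFinset_iff] at hS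
        obtain ⟨v, hv, hvA⟩ := Finset.not_subset.1 hS.2
        rw [Finset.mem_biUnion]
        refine ⟨v, Finset.mem_compl.2 hvA, Finset.mem_image.2 ⟨S.erase v, ?_,
          Finset.insert_erase hv⟩⟩
        rw [Finset.mem_powersetCard, Finset.card_erase_of_mem hv, hS.1.card_eq]
        refine ⟨fun w hw => ?_, rfl⟩
        rw [Finset.mem_erase] at hw
        simpa using hS.1.isClique hv hw.2 hw.1.symm
      · refine Finset.card_image_le.trans ?_
        rw [Finset.card_powersetCard]
        exact Nat.choose_le_choose _ (hlow v (Finset.mem_compl.1 hv))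
  rw [splitCopies]
  omega

/-! ### Extremal graphs and the two bounds. -/

/-- The graph in which `R` is a set of dominating vertices, `A` is a clique, and there are no
further edges. -/
def splitGraph (R A : Finset V) : SimpleGraph V where
  Adj a b := a ≠ b ∧ (a ∈ R ∨ b ∈ R ∨ (a ∈ A ∧ b ∈ A))
  symm := ⟨fun _ _ h => ⟨h.1.symm, by tauto⟩⟩
  loopless := ⟨fun _ h => h.1 rfl⟩

theorem splitCopies_le_sum {s t n k r : ℕ} (hs : 1 ≤ s) (hn : Fintype.card V = n)
    {R A : Finset V} (hRA : R ⊆ A) (hR : R.card = r) (hA : A.card = k - r) :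
    splitCopies s t n k r ≤
      ∑ S ∈ (splitGraph R A).cliqueFinset s, ((splitGraph R A).commonNbrs S).card.choose t := by
  have h1 : r.choose s * (n - s).choose t ≤ ∑ S ∈ R.powersetCard s,
      ((splitGraph R A).commonNbrs S).card.choose t := by
    rw [← hR, ← Finset.card_powersetCard, ← smul_eq_mul]
    refine Finset.card_nsmul_le_sum _ _ _ fun S hS => Nat.choose_le_choose _ ?_
    rw [Finset.mem_powersetCard] at hS
    rw [← hn, ← hS.2, ← Finset.card_compl]
    refine Finset.card_le_card fun w hw => mem_commonNbrs.2 fun v hv => ⟨?_, Or.inl (hS.1 hv)⟩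
    rintro rfl
    exact Finset.mem_compl.1 hw hv
  have h2 : ((k - r).choose s - r.choose s) * (k - r - s).choose t ≤
      ∑ S ∈ A.powersetCard s \ R.powersetCard s,
        ((splitGraph R A).commonNbrs S).card.choose t := by
    rw [← hR, ← Finset.card_powersetCard, hR, ← hA, ← Finset.card_powersetCard,
      ← Finset.card_sdiff_of_subset (Finset.powersetCard_mono hRA), ← smul_eq_mul]
    refine Finset.card_nsmul_le_sum _ _ _ fun S hS => Nat.choose_le_choose _ ?_
    simp only [Finset.mem_sdiff, Finset.mem_powersetCard] at hS
    rw [← hS.1.2, ← Finset.card_sdiff_of_subset hS.1.1]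
    refine Finset.card_le_card fun w hw => mem_commonNbrs.2 fun v hv => ⟨?_, ?_⟩
    · rintro rfl
      exact (Finset.mem_sdiff.1 hw).2 hv
    · exact Or.inr (Or.inr ⟨hS.1.1 hv, (Finset.mem_sdiff.1 hw).1⟩)
  -- Cliques with one vertex outside `A` and the others in `R`; the rest of `R` lies in their common
  -- neighbourhood.
  let K := (Aᶜ ×ˢ R.powersetCard (s - 1)).image (fun p => insert p.1 p.2)
  have hK : ∀ S ∈ K, ∃ v, v ∉ A ∧ ∃ S', S' ⊆ R ∧ S'.card = s - 1 ∧ v ∉ S' ∧ insert v S' = S := by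
    intro S hS
    obtain ⟨⟨v, S'⟩, h, rfl⟩ := Finset.mem_image.1 hS
    simp only [Finset.mem_product, Finset.mem_compl, Finset.mem_powersetCard] at h
    exact ⟨v, h.1, S', h.2.1, h.2.2, fun hh => h.1 (hRA (h.2.1 hh)), rfl⟩
  have hKc : K.card = (n - (k - r)) * r.choose (s - 1) := by
    rw [Finset.card_image_of_injOn, Finset.card_product, Finset.card_compl,
      Finset.card_powersetCard, hn, hA, hR]
    rintro ⟨v, S⟩ h1 ⟨v', S'⟩ h2 h
    simp only [Finset.mem_coe, Finset.mem_product, Finset.mem_compl,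
      Finset.mem_powersetCard] at h1 h2 h
    have hv : v ∉ S := fun hh => h1.1 (hRA (h1.2.1 hh))
    have hv' : v' ∉ S' := fun hh => h2.1 (hRA (h2.2.1 hh))
    have e : v = v' := by
      have : v ∈ insert v' S' := h ▸ Finset.mem_insert_self v S
      rcases Finset.mem_insert.1 this with h3 | h3
      · exact h3
      · exact absurd (hRA (h2.2.1 h3)) h1.1
    subst e
    rw [← Finset.erase_insert hv, h, Finset.erase_insert hv']
  have h3 : (n - (k - r)) * r.choose (s - 1) * (r + 1 - s).choose t ≤
      ∑ S ∈ K, ((splitGraph R A).commonNbrs S).card.choose t := by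
    rw [← hKc, ← smul_eq_mul]
    refine Finset.card_nsmul_le_sum _ _ _ fun S hS => Nat.choose_le_choose _ ?_
    obtain ⟨v, hv, S', hS', hc, hvS, rfl⟩ := hK S hS
    rw [show r + 1 - s = r - (s - 1) by omega, ← hR, ← hc, ← Finset.card_sdiff_of_subset hS']
    refine Finset.card_le_card fun w hw => mem_commonNbrs.2 fun x hx => ⟨?_, ?_⟩
    · rintro rfl
      rw [Finset.mem_sdiff] at hw
      rcases Finset.mem_insert.1 hx with rfl | h
      · exact hv (hRA hw.1)
      · exact hw.2 h
    · exact Or.inr (Or.inl (Finset.mem_sdiff.1 hw).1)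
  have d1 : Disjoint (R.powersetCard s) (A.powersetCard s \ R.powersetCard s) :=
    Finset.disjoint_sdiff
  have d2 : Disjoint (R.powersetCard s ∪ (A.powersetCard s \ R.powersetCard s)) K := by
    rw [Finset.disjoint_right]
    intro S hS hS'
    obtain ⟨v, hv, S', -, -, -, rfl⟩ := hK S hS
    rw [Finset.union_sdiff_of_subset (Finset.powersetCard_mono hRA),
      Finset.mem_powersetCard] at hS'
    exact hv (hS'.1 (Finset.mem_insert_self v S'))
  have hsub : (R.powersetCard s ∪ (A.powersetCard s \ R.powersetCard s)) ∪ K ⊆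
      (splitGraph R A).cliqueFinset s := by
    rw [Finset.union_sdiff_of_subset (Finset.powersetCard_mono hRA)]
    intro S hS
    rw [mem_cliqueFinset_iff]
    rcases Finset.mem_union.1 hS with hS | hS
    · rw [Finset.mem_powersetCard] at hS
      exact ⟨fun a ha b hb hab => ⟨hab, Or.inr (Or.inr ⟨hS.1 ha, hS.1 hb⟩)⟩, hS.2⟩
    · obtain ⟨v, hv, S', hS', hc, hvS, rfl⟩ := hK S hS
      refine ⟨fun a ha b hb hab => ⟨hab, ?_⟩, ?_⟩
      · rw [Finset.mem_coe, Finset.mem_insert] at ha hb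
        rcases ha with rfl | ha
        · rcases hb with rfl | hb
          · exact absurd rfl hab
          · exact Or.inr (Or.inl (hS' hb))
        · exact Or.inl (hS' ha)
      · rw [Finset.card_insert_of_notMem hvS]; omega
  refine le_trans ?_ (Finset.sum_le_sum_of_subset hsub)
  rw [Finset.sum_union d2, Finset.sum_union d1, splitCopies]
  omega

theorem exists_familyFree_splitCopies_le {s t n k r : ℕ} (hs : 1 ≤ s) (ht : 2 ≤ t)
    (hn : k + 1 ≤ n) (hr : 2 * r + 1 ≤ k) :
    ∃ G : SimpleGraph (Fin n), FamilyFree (linearForests n k) G ∧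
      splitCopies s t n k r ≤ G.copyCount (cliqueBipartite s t) := by
  obtain ⟨A, -, hA⟩ := Finset.exists_subset_card_eq
    (show k - r ≤ (Finset.univ : Finset (Fin n)).card by simp; omega)
  obtain ⟨R, hRA, hR⟩ := Finset.exists_subset_card_eq (show r ≤ A.card by omega)
  have hc := Finset.card_sdiff_of_subset hRA
  -- Here `2 * |R| + |A \ R| = 2r + (k - 2r) = k`, exactly what freeness allows.
  refine ⟨splitGraph R A, familyFree_linearForests R (A \ R) (by omega) (by omega) ?_, ?_⟩
  · rintro a b ⟨-, h⟩
    simp only [Finset.mem_sdiff]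
    tauto
  · rw [copyCount_cliqueBipartite _ ht]
    exact splitCopies_le_sum hs (by simp) hRA hR hA

theorem copyCount_le_of_familyFree {s t n k q : ℕ} (hs : 1 ≤ s) (ht : 2 ≤ t) (hk : 1 ≤ k)
    (hn : k + 1 ≤ n) (hq : 2 * q + 1 ≤ k) (hq' : k ≤ 2 * q + 2) {G : SimpleGraph (Fin n)}
    (hG : FamilyFree (linearForests n k) G) :
    G.copyCount (cliqueBipartite s t) ≤ max (splitCopies s t n k 0) (splitCopies s t n k q) := by
  obtain ⟨r, hr, R, A, hRA, hR, hA, hlow, hmid⟩ :=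
    hG.chainsLT.exists_degrees hk (by simpa using hn)
  rw [copyCount_cliqueBipartite _ ht]
  exact (sum_choose_commonNbrs_le hs (by simp) (by omega) hRA hR hA hlow hmid).trans
    (splitCopies_le_max hs (by omega) hn hq (by omega))

end SimpleGraph

theorem theorem1p6 (s t n k p q : ℕ) (hs : 1 ≤ s) (ht : 2 ≤ t) (hk : 1 ≤ k) (hn : k + 1 ≤ n)
    (hp : p = ⌈((k : ℚ) + 1) / 2⌉₊) (hq : q = ⌊((k : ℚ) - 1) / 2⌋₊) :
    SimpleGraph.IsGeneralizedTuranNumber n (SimpleGraph.cliqueBipartite s t)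
      (SimpleGraph.linearForests n k)
      (max (k.choose (s + t) * (s + t).choose t)
        (q.choose s * (n - s).choose t
          + (n - p) * q.choose (s - 1) * (q + 1 - s).choose t
          + (p.choose s - q.choose s) * (p - s).choose t)) := by
  have hq1 : 2 * q + 1 ≤ k ∧ k ≤ 2 * q + 2 := by
    have hk' : (1 : ℚ) ≤ k := by exact_mod_cast hk
    have h1 := Nat.floor_le (show 0 ≤ ((k : ℚ) - 1) / 2 by linarith)
    have h2 := Nat.lt_floor_add_one (((k : ℚ) - 1) / 2)
    rw [← hq] at h1 h2
    have h3 : (2 * q + 1 : ℚ) ≤ k := by linarith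
    have h4 : (k : ℚ) < 2 * q + 3 := by linarith
    norm_cast at h3 h4
    omega
  have hp1 : k + 1 ≤ 2 * p ∧ 2 * p < k + 3 := by
    have h1 := Nat.le_ceil (((k : ℚ) + 1) / 2)
    have h2 := Nat.ceil_lt_add_one (show 0 ≤ ((k : ℚ) + 1) / 2 by positivity)
    rw [← hp] at h1 h2
    have h3 : (k + 1 : ℚ) ≤ 2 * p := by linarith
    have h4 : (2 * p : ℚ) < k + 3 := by linarith
    norm_cast at h3 h4
  -- The ceiling and the floor add up to `k`, so the second term is `splitCopies` at `r = q`; the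
  -- first is its value at `r = 0`.
  obtain rfl : p = k - q := by omega
  rw [← splitCopies_zero (n := n) hs (by omega)]
  change SimpleGraph.IsGeneralizedTuranNumber n _ _
    (max (splitCopies s t n k 0) (splitCopies s t n k q))
  refine ⟨?_, ?_⟩
  · have key : ∀ r, 2 * r + 1 ≤ k →
        max (splitCopies s t n k 0) (splitCopies s t n k q) = splitCopies s t n k r →
        max (splitCopies s t n k 0) (splitCopies s t n k q) ∈
          {c | ∃ G : SimpleGraph (Fin n), SimpleGraph.FamilyFree (SimpleGraph.linearForests n k) G ∧
            G.copyCount (SimpleGraph.cliqueBipartite s t) = c} := by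
      intro r hr h
      obtain ⟨G, hG, hle⟩ := SimpleGraph.exists_familyFree_splitCopies_le hs ht hn hr
      exact ⟨G, hG, le_antisymm (SimpleGraph.copyCount_le_of_familyFree hs ht hk hn hq1.1 hq1.2 hG)
        (h.trans_le hle)⟩
    rcases max_choice (splitCopies s t n k 0) (splitCopies s t n k q) with h | h
    · exact key 0 (by omega) h
    · exact key q hq1.1 h
  · rintro c ⟨G, hG, rfl⟩
    exact SimpleGraph.copyCount_le_of_familyFree hs ht hk hn hq1.1 hq1.2 hG
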